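/- Conventions. All Hilbert spaces are complex and separable. A density operator on a Hilbert space is a nonzero positive semidefinite trace-class operator (not necessarily of trace $1$); $DO(\mathcal H)$ is the set of density operators on $\mathcal H$. A measurement over $\mathcal K$ is a countable family $\langle L_i : i\in I\rangle$ of bounded operators on $\mathcal K$ with $\sum_{i\in I} L_i^\dagger L_i=\mathrm{Id}$ in the weak operator topology; the elements of $I$ are its outcomes, and outcome $i$ changes the state $\sigma$ to the (unnormalized) state $L_i\sigma L_i^\dagger$. A quantum circuit $\mathcal C$ consists of finitely many quantum wires, each carrying a Hilbert space, and finitely many gates, each acting on a nonempty set of wires, together with classical channels between gates and a fixed execution schedule $(B_1,\dots,B_N)$ that partitions the gates into sets $B_n$ of gates fired simultaneously; gates in the same $B_n$ act on disjoint sets of wires, and the classical sources of a gate (the gates with a classical channel to it) are fired strictly before it. Every gate $G$ is assigned a finite nonempty set of measurements over the tensor product of the spaces of its wires, with pairwise disjoint outcome sets, and a selection function $\Sigma_G$, onto this set, that picks the measurement to be executed from the outcomes of the classical sources of $G$. (Unitary gates are measurements with a single outcome.) A computation path $\mu$ assigns to every gate $G$ an outcome $\mu(G)$ of the measurement that $\Sigma_G$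 picks given the outcomes $\mu(F)$ of the classical sources $F$ of $G$. For a density operator $\sigma$ on the tensor product $\mathcal K$ of all wire spaces, $\mathrm{Out}_{\mathcal C}(\mu\,|\,\sigma)$ is the unnormalized state obtained from $\sigma$ by applying, along the schedule, the operators of the outcomes $\mu(G)$ (tensored with the identity on the other wires). Let $\mathcal H$ and $\mathcal A$ be Hilbert spaces with $\dim\mathcal H\ge 2$, where $\mathcal K$ is identified with $\mathcal H\otimes\mathcal A$ by a unitary at the input and by a (possibly different) unitary at the output: $\mathcal H$ hosts the principal input and output, and $\mathcal A$ hosts the ancillas at the beginning and the garbage at the end. Let $|a\rangle$ be a fixed unit vector in $\mathcal A$. The circuit $\mathcal C$ computes a bounded linear operator $U$ on $\mathcal H$ along a path $\mu$ if, for every $\rho\in DO(\mathcal H)$, there is a scalar $c\ge 0$ (depending on $\mu$ and $\rho$, and $0$ where $\mu$ has probability zero) such that $$\mathrm{Tr}_{\mathcal A}\big(\mathrm{Out}_{\mathcal C}(\mu\,|\,\rho\otimes|a\rangle\langle a|)\big)=c\cdot U\rho\,U^\dagger .$$ Proposition B.2. If a quantum circuit $\mathcal C$ computes the same bounded linear operator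 $U$ on $\mathcal H$ along every computation path, then $U$ is an isometry up to a positive scalar factor: there is a real number $t>0$ such that $\|tU\psi\|=\|\psi\|$ for every $\psi\in\mathcal H$. -/

import Mathlib

open scoped TensorProduct lp InnerProductSpace

noncomputable section

namespace QCirc

/-! ### Hilbert space tensor products, density operators, partial traces -/

section Hilbert

variable {H A : Type*}
  [NormedAddCommGroup H] [InnerProductSpace ℂ H]
  [NormedAddCommGroup A] [InnerProductSpace ℂ A]

variable (H A) in
/-- The Hilbert space tensor product: the completion of the algebraic tensor product with respect
to the inner product `⟪x ⊗ y, x' ⊗ y'⟫ = ⟪x, x'⟫ * ⟪y, y'⟫`. -/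
abbrev HTensor : Type _ := UniformSpace.Completion (H ⊗[ℂ] A)

/-- The product vector `x ⊗ y`. -/
def htmul (x : H) (y : A) : HTensor H A := ((x ⊗ₜ[ℂ] y : H ⊗[ℂ] A) : HTensor H A)

/-- The tensor product `S ⊗ T` of bounded operators, acting on the completed tensor product. -/
def htmap (S : H →L[ℂ] H) (T : A →L[ℂ] A) : HTensor H A →L[ℂ] HTensor H A :=
  (TensorProduct.mapL S T).completion

theorem htmap_htmul (S : H →L[ℂ] H) (T : A →L[ℂ] A) (x : H) (y : A) :
    htmap S T (htmul x y) = htmul (S x) (T y) := by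
  simp [htmap, htmul]

/-- Density operators, not necessarily normalized: nonzero positive semidefinite (in particular
Hermitian) bounded operators of finite trace. -/
structure IsDensity
    (ρ : H →L[ℂ] H) : Prop where
  ne_zero : ρ ≠ 0
  isPositive : ρ.IsPositive
  summable_trace : ∀ (s : Set H) (e : HilbertBasis s ℂ H),
    Summable fun i => RCLike.re ⟪e i, ρ (e i)⟫_ℂ

/-- `S` is the partial trace `Tr_A T` of the operator `T` on `H ⊗ A`: for every Hilbert basis
`(f j)` of `A`, `⟪x, S y⟫ = ∑ j, ⟪x ⊗ f j, T (y ⊗ f j)⟫`. -/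
def HasPartialTrace (T : HTensor H A →L[ℂ] HTensor H A) (S : H →L[ℂ] H) : Prop :=
  ∀ (s : Set A) (f : HilbertBasis s ℂ A) (x y : H),
    HasSum (fun j => ⟪htmul x (f j), T (htmul y (f j))⟫_ℂ) ⟪x, S y⟫_ℂ

/-- A (general) measurement over a Hilbert space: a countable family of bounded operators `L i`
such that `∑ i, (L i)† (L i)` converges to the identity in the weak operator topology. -/
structure Measurement (K : Type*) [NormedAddCommGroup K] [InnerProductSpace ℂ K]
    [CompleteSpace K] where
  /-- the classical outcomes -/
  Outcome : Type
  [countable_outcome : Countable Outcome]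
  /-- the operator belonging to an outcome -/
  op : Outcome → K →L[ℂ] K
  hasSum_op : HasSum
    (fun i => ContinuousLinearMapWOT.ofCLM (ContinuousLinearMap.adjoint (op i) ∘L op i))
    (ContinuousLinearMapWOT.ofCLM (ContinuousLinearMap.id ℂ K))

end Hilbert

/-! ### Operators acting on part of a register -/

section Ampliation

variable {Z J I : Type*}

theorem slice_mem (e : Z ≃ J × I) (f : ℓ²(Z, ℂ)) (j : J) :
    Memℓp (fun i : I => f (e.symm (j, i))) 2 := by
  have h := (memℓp_gen_iff (by norm_num)).1 (lp.memℓp f)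
  refine (memℓp_gen_iff (by norm_num)).2 ?_
  exact h.comp_injective (i := fun i : I => e.symm (j, i)) fun a b hab => by simpa using hab

/-- The restriction of `f ∈ ℓ²(J × I)` to the fibre `{j} × I`. -/
def slice (e : Z ≃ J × I) (f : ℓ²(Z, ℂ)) (j : J) : ℓ²(I, ℂ) :=
  ⟨fun i => f (e.symm (j, i)), slice_mem e f j⟩

theorem norm_sq_eq (f : ℓ²(I, ℂ)) : HasSum (fun i => ‖f i‖ ^ 2) (‖f‖ ^ 2) := by
  have h := lp.hasSum_norm (p := 2) (by norm_num) f
  simpa using h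

theorem hasSum_slice (e : Z ≃ J × I) (f : ℓ²(Z, ℂ)) :
    HasSum (fun j => ‖slice e f j‖ ^ 2) (‖f‖ ^ 2) := by
  have h := (Equiv.hasSum_iff e.symm).2 (norm_sq_eq f)
  exact h.prod_fiberwise fun j => norm_sq_eq (slice e f j)

theorem hasSum_ampl (e : Z ≃ J × I) (L : ℓ²(I, ℂ) →L[ℂ] ℓ²(I, ℂ)) (f : ℓ²(Z, ℂ)) :
    ∃ t ≤ (‖L‖ * ‖f‖) ^ 2, HasSum (fun z => ‖L (slice e f (e z).1) (e z).2‖ ^ 2) t := by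
  have hle : ∀ j, ‖L (slice e f j)‖ ^ 2 ≤ ‖L‖ ^ 2 * ‖slice e f j‖ ^ 2 := fun j => by
    rw [← mul_pow]
    gcongr
    exact L.le_opNorm _
  have hs := (hasSum_slice e f).mul_left (‖L‖ ^ 2)
  have hsum : Summable fun j => ‖L (slice e f j)‖ ^ 2 :=
    Summable.of_nonneg_of_le (fun _ => by positivity) hle hs.summable
  have hprod : Summable fun p : J × I => ‖L (slice e f p.1) p.2‖ ^ 2 := by
    refine (summable_prod_of_nonneg fun _ => by positivity).2
      ⟨fun j => (norm_sq_eq (L (slice e f j))).summable, ?_⟩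
    simpa only [(norm_sq_eq (L (slice e f _))).tsum_eq] using hsum
  have h1 := hprod.hasSum.prod_fiberwise fun j => norm_sq_eq (L (slice e f j))
  refine ⟨_, ?_, (Equiv.hasSum_iff e).2 hprod.hasSum⟩
  rw [mul_pow]
  exact hasSum_le hle h1 hs

/-- For an operator `L` on `ℓ²(I)`, the linear map `1 ⊗ L` on `ℓ²(J × I) = ℓ²(J) ⊗ ℓ²(I)`:
`L` is applied on each fibre `{j} × I`. -/
def ampliateₗ (e : Z ≃ J × I) (L : ℓ²(I, ℂ) →L[ℂ] ℓ²(I, ℂ)) : ℓ²(Z, ℂ) →ₗ[ℂ] ℓ²(Z, ℂ) where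
  toFun f := ⟨fun z => L (slice e f (e z).1) (e z).2, by
    obtain ⟨t, -, ht⟩ := hasSum_ampl e L f
    exact (memℓp_gen_iff (by norm_num)).2 (by simpa using ht.summable)⟩
  map_add' f g := by
    ext z
    have : slice e (f + g) (e z).1 = slice e f (e z).1 + slice e g (e z).1 := rfl
    simp only [this, map_add]
    rfl
  map_smul' c f := by
    ext z
    have : slice e (c • f) (e z).1 = c • slice e f (e z).1 := rfl
    simp only [this, map_smul]
    rfl

theorem norm_ampliateₗ_le (e : Z ≃ J × I) (L : ℓ²(I, ℂ) →L[ℂ] ℓ²(I, ℂ)) (f : ℓ²(Z, ℂ)) :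
    ‖ampliateₗ e L f‖ ≤ ‖L‖ * ‖f‖ := by
  obtain ⟨t, htle, ht⟩ := hasSum_ampl e L f
  have h : ‖ampliateₗ e L f‖ ^ 2 = t := (norm_sq_eq (ampliateₗ e L f)).unique ht
  exact (sq_le_sq₀ (norm_nonneg _) (by positivity)).1 (h ▸ htle)

/-- The operator `1 ⊗ L` on `ℓ²(J × I) = ℓ²(J) ⊗ ℓ²(I)` as a bounded operator. -/
def ampliate (e : Z ≃ J × I) (L : ℓ²(I, ℂ) →L[ℂ] ℓ²(I, ℂ)) : ℓ²(Z, ℂ) →L[ℂ] ℓ²(Z, ℂ) :=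
  (ampliateₗ e L).mkContinuous ‖L‖ (norm_ampliateₗ_le e L)

theorem ampliate_apply (e : Z ≃ J × I) (L : ℓ²(I, ℂ) →L[ℂ] ℓ²(I, ℂ)) (f : ℓ²(Z, ℂ)) (z : Z) :
    ampliate e L f z = L (slice e f (e z).1) (e z).2 := rfl

end Ampliation

/-! ### Quantum circuits -/

/-- The Hilbert space of a set `S` of wires. Wire `w` carries the separable Hilbert space with
orthonormal basis labelled by the countable set `Label w` (every separable Hilbert space is of this
form, up to a unitary), so the tensor product of the spaces of the wires in `S` is `ℓ²` of the joint
labels. -/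
abbrev Register {m : ℕ} (Label : Fin m → Type) (S : Finset (Fin m)) : Type :=
  ℓ²((w : {w // w ∈ S}) → Label w, ℂ)

/-- Splitting the joint labels of all wires into those outside and those inside `S`. -/
def splitLabels {m : ℕ} (Label : Fin m → Type) (S : Finset (Fin m)) :
    ((w : Fin m) → Label w) ≃
      ((w : {w // w ∉ S}) → Label w) × ((w : {w // w ∈ S}) → Label w) :=
  (Equiv.piEquivPiSubtypeProd (fun w => w ∈ S) Label).trans (Equiv.prodComm _ _)

/-- A quantum circuit with classical channels and a fixed execution schedule. Unitary gates are
measurement gates with a single outcome. -/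
structure QCircuit where
  /-- the number of quantum wires -/
  numWires : ℕ
  /-- the labels of an orthonormal basis of the Hilbert space carried by a wire -/
  Label : Fin numWires → Type
  [countable_label : ∀ w, Countable (Label w)]
  /-- the number of gates; the gates come with a fixed linear order -/
  numGates : ℕ
  /-- the wires that a gate acts on -/
  wires : Fin numGates → Finset (Fin numWires)
  wires_nonempty : ∀ G, (wires G).Nonempty
  /-- the length of the schedule -/
  depth : ℕ
  /-- the schedule: gate `G` belongs to the bout number `time G` -/
  time : Fin numGates → Fin depth
  /-- gates that share a wire are never fired simultaneously; so along each wire the schedule is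
  consistent with the order of the gates (quantum prerequisites) -/
  parallel : ∀ F G, F ≠ G → time F = time G → Disjoint (wires F) (wires G)
  /-- the classical sources of a gate: the gates with a classical channel to it -/
  sources : Fin numGates → Finset (Fin numGates)
  sources_before : ∀ G, ∀ F ∈ sources G, time F < time G
  /-- an index for the finite nonempty set of measurements assigned to a gate -/
  Alt : Fin numGates → Type
  [finite_alt : ∀ G, Finite (Alt G)]
  [nonempty_alt : ∀ G, Nonempty (Alt G)]
  /-- the measurements assigned to a gate -/
  meas : ∀ G, Alt G → Measurement (Register Label (wires G))
  /-- the selection function of a gate: it picks the measurement to be executed, given the outcomes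
  of the classical sources. Outcomes are tagged by the measurement that they belong to, so different
  measurements of a gate have disjoint sets of outcomes. -/
  select : ∀ G, ((F : {F // F ∈ sources G}) → Σ i : Alt F, (meas F i).Outcome) → Alt G
  /-- there are no superfluous measurements -/
  select_surjective : ∀ G, Function.Surjective (select G)

namespace QCircuit

variable (C : QCircuit)

/-- The possible outcomes of a gate (over all measurements assigned to it). -/
abbrev Outcome (G : Fin C.numGates) : Type := Σ i : C.Alt G, (C.meas G i).Outcome

/-- The Hilbert space of full inputs and outputs: all wires together. -/
abbrev Space : Type := ℓ²((w : Fin C.numWires) → C.Label w, ℂ)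

/-- A computation path: an assignment of outcomes to gates such that the outcome assigned to `G` is
an outcome of the measurement selected by the outcomes of the classical sources of `G`. -/
structure Path where
  /-- the outcome assigned to a gate -/
  outcome : (G : Fin C.numGates) → C.Outcome G
  coherent : ∀ G, (outcome G).1 = C.select G fun F => outcome F

variable {C}

/-- The operator on the full space performed by gate `G` along a path: the operator of the gate's
outcome on the wires of `G`, tensored with the identity on all other wires. -/
def gateOp (μ : C.Path) (G : Fin C.numGates) : C.Space →L[ℂ] C.Space :=
  ampliate (splitLabels C.Label (C.wires G)) ((C.meas G (μ.outcome G).1).op (μ.outcome G).2)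

/-- The operator performed by bout number `k` along a path: the tensor product of the operators of
its gates, with the identity on the unused wires. As the gates of a bout act on disjoint sets of
wires, this is the product of the (pairwise commuting) operators `gateOp μ G`, `G` in the bout. -/
def boutOp (μ : C.Path) (k : ℕ) : C.Space →L[ℂ] C.Space :=
  (((List.finRange C.numGates).filter fun G => (C.time G : ℕ) = k).map (gateOp μ)).prod

/-- The (unnormalized) state after the first `k` bouts along a path, on full input `σ`: outcomes
with operator `L` change the state from `σ` to `L σ L†`. -/
def stateAfter (μ : C.Path) (σ : C.Space →L[ℂ] C.Space) : ℕ → C.Space →L[ℂ] C.Space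
  | 0 => σ
  | k + 1 => boutOp μ k ∘L stateAfter μ σ k ∘L ContinuousLinearMap.adjoint (boutOp μ k)

/-- The output of the circuit along path `μ` on full input `σ`. -/
def output (μ : C.Path) (σ : C.Space →L[ℂ] C.Space) : C.Space →L[ℂ] C.Space :=
  stateAfter μ σ C.depth

variable {H A : Type*}
  [NormedAddCommGroup H] [InnerProductSpace ℂ H] [CompleteSpace H]
  [NormedAddCommGroup A] [InnerProductSpace ℂ A] [CompleteSpace A]

/-- The full input `ρ ⊗ |a⟩⟨a|`, as an operator on the space of the circuit; `inp` identifies this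
space with `H ⊗ A`, where `H` hosts the principal input and `A` the ancillas. -/
def fullInput (inp : HTensor H A ≃ₗᵢ[ℂ] C.Space) (a : A) (ρ : H →L[ℂ] H) :
    C.Space →L[ℂ] C.Space :=
  inp.toContinuousLinearEquiv.toContinuousLinearMap ∘L
    htmap ρ (InnerProductSpace.rankOne ℂ a a) ∘L
    inp.symm.toContinuousLinearEquiv.toContinuousLinearMap

/-- The output along `μ` on full input `ρ ⊗ |a⟩⟨a|`, as an operator on `H ⊗ A`; `out` identifies the
space of the circuit with `H ⊗ A`, where `H` hosts the principal output and `A` the garbage. -/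
def fullOutput (inp out : HTensor H A ≃ₗᵢ[ℂ] C.Space) (a : A) (μ : C.Path) (ρ : H →L[ℂ] H) :
    HTensor H A →L[ℂ] HTensor H A :=
  out.symm.toContinuousLinearEquiv.toContinuousLinearMap ∘L
    output μ (fullInput inp a ρ) ∘L
    out.toContinuousLinearEquiv.toContinuousLinearMap

/-- The circuit computes `U` along the path `μ`: for every density operator `ρ` on `H`, the principal
output `Tr_A (Out(μ | ρ ⊗ |a⟩⟨a|))` agrees with `U ρ U†` up to a scalar factor (which vanishes where
the path has probability zero). -/
def ComputesAlong (inp out : HTensor H A ≃ₗᵢ[ℂ] C.Space) (a : A) (U : H →L[ℂ] H) (μ : C.Path) :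
    Prop :=
  ∀ ρ : H →L[ℂ] H, IsDensity ρ → ∃ c : ℝ, 0 ≤ c ∧
    HasPartialTrace (fullOutput inp out a μ ρ)
      ((c : ℂ) • (U ∘L ρ ∘L ContinuousLinearMap.adjoint U))

end QCircuit

end QCirc

end

noncomputable section

namespace QCirc

/-! ### Conservation of probability -/

section Probability

/-! Along a path `μ` the circuit applies one linear operator, so a pure input `ψ` yields a vector
`W_μ ψ` in `H ⊗ A`. Its partial trace is a multiple of `|Uψ⟩⟨Uψ|`, which forces `W_μ ψ = Uψ ⊗ α`
(`ComputesAlong.exists_outVec_eq`). Path probabilities add up: `∑_μ ‖W_μ ψ‖² = ‖ψ‖²`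
(`tsum_enorm_pathOp_sq`), so `U` is injective.

A priori `α` depends on `ψ`. Linearity of `W_μ` and injectivity of `U` make it agree for linearly
independent inputs, so `‖W_μ ψ‖` is proportional to `‖Uψ‖` (`norm_mul_norm_eq_of_eq_htmul`). Summing
squares over paths makes `‖ψ‖` proportional to `‖Uψ‖`.

Sums of squared norms are taken in `ℝ≥0∞`, where they may be reordered freely. -/

theorem enorm_sq_eq_ofReal {F : Type*} [SeminormedAddCommGroup F] (v : F) :
    ‖v‖ₑ ^ 2 = ENNReal.ofReal (‖v‖ ^ 2) := by
  rw [ENNReal.ofReal_pow (norm_nonneg _), ofReal_norm]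

theorem tsum_enorm_sq_of_hasSum {ι E F : Type*} [SeminormedAddCommGroup E]
    [SeminormedAddCommGroup F] {f : ι → E} {v : F}
    (h : HasSum (fun i => ‖f i‖ ^ 2) (‖v‖ ^ 2)) : ∑' i, ‖f i‖ₑ ^ 2 = ‖v‖ₑ ^ 2 := by
  simp only [enorm_sq_eq_ofReal]
  rw [← h.tsum_eq, ENNReal.ofReal_tsum_of_nonneg (fun _ => by positivity) h.summable]

theorem Measurement.tsum_enorm_op_sq {K : Type*} [NormedAddCommGroup K] [InnerProductSpace ℂ K]
    [CompleteSpace K] (M : Measurement K) (v : K) :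
    ∑' i, ‖M.op i v‖ₑ ^ 2 = ‖v‖ₑ ^ 2 := by
  refine tsum_enorm_sq_of_hasSum ?_
  -- Weak operator convergence tested on `v` and the functional `⟪v, ·⟫`; the terms become `‖L v‖²`.
  have h := Pi.hasSum.1 (M.hasSum_op.map
    (ContinuousLinearMapWOT.inducingFn (RingHom.id ℂ) K K)
    ContinuousLinearMapWOT.continuous_inducingFn) (v, innerSL ℂ v)
  simpa [Function.comp_def, ContinuousLinearMap.adjoint_inner_right, ← Complex.ofReal_pow,
    Complex.hasSum_ofReal] using h

variable {Z J I : Type*}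

theorem slice_ampliate (e : Z ≃ J × I) (L : ℓ²(I, ℂ) →L[ℂ] ℓ²(I, ℂ)) (f : ℓ²(Z, ℂ)) (j : J) :
    slice e (ampliate e L f) j = L (slice e f j) := by
  ext i
  change ampliate e L f (e.symm (j, i)) = _
  simp [ampliate_apply]

/-- `1 ⊗ L` acts fibrewise and the squared norm is the sum over fibres, so exchanging the two sums
reduces to `M` on each fibre. -/
theorem Measurement.tsum_enorm_ampliate_sq (M : Measurement ℓ²(I, ℂ)) (e : Z ≃ J × I)
    (f : ℓ²(Z, ℂ)) : ∑' i, ‖ampliate e (M.op i) f‖ₑ ^ 2 = ‖f‖ₑ ^ 2 := by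
  have h : ∀ g : ℓ²(Z, ℂ), ‖g‖ₑ ^ 2 = ∑' j, ‖slice e g j‖ₑ ^ 2 := fun g =>
    (tsum_enorm_sq_of_hasSum (hasSum_slice e g)).symm
  simp_rw [h, slice_ampliate]
  rw [ENNReal.tsum_comm]
  simp_rw [M.tsum_enorm_op_sq]

theorem conj_iterate {K : Type*} [NormedAddCommGroup K] [InnerProductSpace ℂ K] [CompleteSpace K]
    {B P S : ℕ → K →L[ℂ] K} {σ : K →L[ℂ] K} (hP0 : P 0 = 1) (hS0 : S 0 = σ)
    (hP : ∀ k, P (k + 1) = B k ∘L P k)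
    (hS : ∀ k, S (k + 1) = B k ∘L S k ∘L ContinuousLinearMap.adjoint (B k)) (k : ℕ) :
    S k = P k ∘L σ ∘L ContinuousLinearMap.adjoint (P k) := by
  induction k with
  | zero =>
    rw [hP0, hS0, ← ContinuousLinearMap.star_eq_adjoint, star_one]
    rfl
  | succ k ih =>
    rw [hP, hS, ih, ContinuousLinearMap.adjoint_comp]
    simp only [ContinuousLinearMap.comp_assoc]

end Probability

/-! ### Summation over computation paths -/

namespace QCircuit

open Classical in
/-- The operator that gate `G` performs on outcome `x` if measurement `s` is selected: it is `0`
unless `x` is an outcome of `s`. -/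
def selectedOp {C : QCircuit} (G : Fin C.numGates) (s : C.Alt G) (x : C.Outcome G) :
    C.Space →L[ℂ] C.Space :=
  if x.1 = s then ampliate (splitLabels C.Label (C.wires G)) ((C.meas G x.1).op x.2) else 0

/-- The operator that gate `G` performs under an assignment `o` of outcomes to all gates; it is `0`
if `o G` does not belong to the measurement that is selected by `o`. -/
def maskedOp {C : QCircuit} (o : ∀ G, C.Outcome G) (G : Fin C.numGates) : C.Space →L[ℂ] C.Space :=
  selectedOp G (C.select G fun F => o F) (o G)

variable {C : QCircuit}

theorem tsum_enorm_selectedOp_sq (G : Fin C.numGates) (s : C.Alt G) (Ψ : C.Space) :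
    ∑' x, ‖selectedOp G s x Ψ‖ₑ ^ 2 = ‖Ψ‖ₑ ^ 2 := by
  refine (ENNReal.tsum_sigma' fun x : C.Outcome G => ‖selectedOp G s x Ψ‖ₑ ^ 2).trans ?_
  rw [tsum_eq_single s]
  · rw [← (C.meas G s).tsum_enorm_ampliate_sq (splitLabels C.Label (C.wires G)) Ψ]
    refine tsum_congr fun x => ?_
    rw [selectedOp, if_pos rfl]
  · intro i hi
    have h : ∀ x, selectedOp G s ⟨i, x⟩ = 0 := fun x => if_neg hi
    simp [h]

theorem maskedOp_congr {o o' : ∀ G, C.Outcome G} {G : Fin C.numGates} (hG : o G = o' G)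
    (hs : ∀ F ∈ C.sources G, o F = o' F) : maskedOp o G = maskedOp o' G := by
  have : (fun F : {F // F ∈ C.sources G} => o F) = fun F : {F // F ∈ C.sources G} => o' F :=
    funext fun F => hs F.1 F.2
  rw [maskedOp, maskedOp, hG]
  exact congrArg (fun f => selectedOp G (C.select G f) (o' G)) this

/-- A gate is not its own source, so varying its outcome leaves the selected measurement fixed. -/
theorem tsum_enorm_maskedOp_sq (o : ∀ G, C.Outcome G) (G : Fin C.numGates)
    (hG : G ∉ C.sources G) (Ψ : C.Space) :
    ∑' x, ‖maskedOp (Function.update o G x) G Ψ‖ₑ ^ 2 = ‖Ψ‖ₑ ^ 2 := by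
  rw [← tsum_enorm_selectedOp_sq G (C.select G fun F => o F) Ψ]
  refine tsum_congr fun x => ?_
  have hs : (fun F : {F // F ∈ C.sources G} => Function.update o G x F) =
      fun F : {F // F ∈ C.sources G} => o F := funext fun F =>
    Function.update_of_ne (fun h => hG (h.subst (motive := (· ∈ C.sources G)) F.2)) _ _
  rw [maskedOp, Function.update_self]
  exact congrArg (fun f => ‖selectedOp G (C.select G f) x Ψ‖ₑ ^ 2) hs

-- Adaptive choice makes the paths a dependent family. Masking permits summing over all outcome
-- assignments instead, since incoherent ones contribute zero. The last gate of `l` acts first on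
-- `Ψ`, hence induction from the right; outcomes outside `l` are frozen at `o`, which must stay
-- general because the induction changes it.
open Classical in
theorem tsum_enorm_prod_maskedOp_sq (l : List (Fin C.numGates))
    (hl : l.Pairwise fun F G => F ≠ G ∧ F ∉ C.sources G) (hirr : ∀ G, G ∉ C.sources G)
    (o : ∀ G, C.Outcome G) (Ψ : C.Space) :
    ∑' o' : ∀ G, C.Outcome G, (if ∀ G, G ∉ l → o' G = o G then
      ‖(l.map (maskedOp o')).prod Ψ‖ₑ ^ 2 else 0) = ‖Ψ‖ₑ ^ 2 := by
  induction l using List.reverseRecOn generalizing o Ψ with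
  | nil =>
    rw [tsum_eq_single o]
    · simp
    · intro o' ho'
      exact if_neg fun h => ho' (funext fun G => h G (by simp))
  | append_singleton l G ih =>
    obtain ⟨hl', -, hlG⟩ := List.pairwise_append.1 hl
    have hlG : ∀ F ∈ l, F ≠ G ∧ F ∉ C.sources G := fun F hF => hlG F hF G (by simp)
    have hGl : G ∉ l := fun h => (hlG G h).1 rfl
    rw [← tsum_enorm_maskedOp_sq o G (hirr G) Ψ]
    simp_rw [← fun x => ih hl' (Function.update o G x) (maskedOp (Function.update o G x) G Ψ)]
    rw [ENNReal.tsum_comm]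
    refine tsum_congr fun o' => ?_
    -- As `G ∉ l`, the constraint on `o'` forces the outcome `x` summed for `G` to be `o' G`.
    rw [tsum_eq_single (o' G)]
    · have hiff : (∀ F, F ∉ l ++ [G] → o' F = o F) ↔
          ∀ F, F ∉ l → o' F = Function.update o G (o' G) F := by
        refine forall_congr' fun F => ?_
        by_cases hF : F = G
        · subst hF; simp
        · simp [hF]
      refine if_ctx_congr hiff (fun h => ?_) fun _ => rfl
      -- No source of `G` lies in `l`, so the frozen outcomes already determine the measurement at
      -- `G`.
      have : maskedOp (Function.update o G (o' G)) G = maskedOp o' G :=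
        maskedOp_congr (by simp) fun F hF => (h F fun hFl => (hlG F hFl).2 hF).symm
      simp [this]
    · intro x hx
      refine if_neg fun h => hx ?_
      simpa using (h G hGl).symm

/-- The gates of the first `k` bouts, those fired last first. -/
def gateList (C : QCircuit) : ℕ → List (Fin C.numGates)
  | 0 => []
  | k + 1 => ((List.finRange C.numGates).filter fun G => (C.time G : ℕ) = k) ++ gateList C k

theorem mem_gateList {k : ℕ} {G : Fin C.numGates} : G ∈ gateList C k ↔ (C.time G : ℕ) < k := by
  induction k with
  | zero => simp [gateList]
  | succ k ih => simp [gateList, ih]; omega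

theorem notMem_sources_self (G : Fin C.numGates) : G ∉ C.sources G := fun h =>
  lt_irrefl _ (C.sources_before G G h)

/-- A gate further left is fired no earlier, whereas sources are fired strictly earlier. -/
theorem pairwise_gateList (k : ℕ) :
    (gateList C k).Pairwise fun F G => F ≠ G ∧ F ∉ C.sources G := by
  induction k with
  | zero => simp [gateList]
  | succ k ih =>
    refine List.pairwise_append.2 ⟨?_, ih, fun F hF G hG => ?_⟩
    · have hn : ((List.finRange C.numGates).filter fun G => (C.time G : ℕ) = k).Pairwise (· ≠ ·) :=
        (List.nodup_finRange _).filter _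
      refine hn.imp_of_mem fun {F G} hF hG h => ⟨h, fun hs => ?_⟩
      have := C.sources_before G F hs
      simp only [List.mem_filter, List.mem_finRange, decide_eq_true_eq, true_and] at hF hG
      rw [Fin.lt_def] at this
      omega
    · rw [mem_gateList] at hG
      simp only [List.mem_filter, List.mem_finRange, decide_eq_true_eq, true_and] at hF
      refine ⟨by rintro rfl; omega, fun hs => ?_⟩
      have := C.sources_before G F hs
      rw [Fin.lt_def] at this
      omega

/-- The operator performed by the whole circuit along a path. -/
def pathOp (μ : C.Path) : C.Space →L[ℂ] C.Space :=
  ((gateList C C.depth).map (gateOp μ)).prod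

theorem prod_gateList_succ (μ : C.Path) (k : ℕ) :
    ((gateList C (k + 1)).map (gateOp μ)).prod =
      boutOp μ k ∘L ((gateList C k).map (gateOp μ)).prod := by
  rw [gateList, List.map_append, List.prod_append]
  rfl

theorem output_eq (μ : C.Path) (σ : C.Space →L[ℂ] C.Space) :
    output μ σ = pathOp μ ∘L σ ∘L ContinuousLinearMap.adjoint (pathOp μ) :=
  conj_iterate (S := stateAfter μ σ) (P := fun k => ((gateList C k).map (gateOp μ)).prod)
    (B := boutOp μ) rfl rfl (prod_gateList_succ μ) (fun _ => rfl) C.depth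

theorem maskedOp_path (μ : C.Path) (G : Fin C.numGates) : maskedOp μ.outcome G = gateOp μ G :=
  if_pos (μ.coherent G)

/-- Path probabilities sum up to the full probability. -/
theorem tsum_enorm_pathOp_sq (Ψ : C.Space) : ∑' μ : C.Path, ‖pathOp μ Ψ‖ₑ ^ 2 = ‖Ψ‖ₑ ^ 2 := by
  classical
  rcases eq_or_ne Ψ 0 with rfl | hΨ
  · simp
  -- A base assignment is needed. A measurement without outcomes would give `‖Ψ‖² = 0`, which is why
  -- `Ψ = 0` was split off.
  have hne : ∀ G, Nonempty (C.Outcome G) := fun G => by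
    obtain ⟨i⟩ := C.nonempty_alt G
    by_contra hempty
    have : IsEmpty (C.meas G i).Outcome := ⟨fun x => hempty ⟨⟨i, x⟩⟩⟩
    have h := (C.meas G i).tsum_enorm_ampliate_sq (splitLabels C.Label (C.wires G)) Ψ
    rw [tsum_empty] at h
    exact hΨ (enorm_eq_zero.1 (pow_eq_zero_iff two_ne_zero |>.1 h.symm))
  let o : ∀ G, C.Outcome G := fun G => (hne G).some
  rw [← tsum_enorm_prod_maskedOp_sq (gateList C C.depth) (pairwise_gateList _) notMem_sources_self
    o Ψ]
  have hinj : Function.Injective (Path.outcome : C.Path → _) := fun μ ν h => by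
    cases μ; cases ν; cases h; rfl
  have hall : ∀ G, G ∈ gateList C C.depth := fun G => mem_gateList.2 (C.time G).2
  simp_rw [hall, not_true, false_imp_iff, implies_true, if_true]
  rw [← hinj.tsum_eq]
  · simp_rw [pathOp, funext (maskedOp_path _)]
  · intro o' ho'
    by_contra hr
    have hcoh : ¬ ∀ G, (o' G).1 = C.select G fun F => o' F := fun h => hr ⟨⟨o', h⟩, rfl⟩
    obtain ⟨G, hG⟩ := not_forall.1 hcoh
    refine ho' ?_
    have : ((gateList C C.depth).map (maskedOp o')).prod = 0 :=
      List.prod_eq_zero (List.mem_map.2 ⟨G, hall G, if_neg hG⟩)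
    simp [this]

end QCircuit

/-! ### Product vectors -/

section Product

variable {H A : Type*}
  [NormedAddCommGroup H] [InnerProductSpace ℂ H]
  [NormedAddCommGroup A] [InnerProductSpace ℂ A]

theorem inner_htmul (x x' : H) (y y' : A) :
    ⟪htmul x y, htmul x' y'⟫_ℂ = ⟪x, x'⟫_ℂ * ⟪y, y'⟫_ℂ := by
  rw [htmul, htmul, UniformSpace.Completion.inner_coe, TensorProduct.inner_tmul]

theorem norm_htmul (x : H) (y : A) : ‖htmul x y‖ = ‖x‖ * ‖y‖ := by
  rw [htmul, UniformSpace.Completion.norm_coe, TensorProduct.norm_tmul]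

variable (H A) in
/-- The product vector as a bilinear map. -/
def htmulₗ : H →ₗ[ℂ] A →ₗ[ℂ] HTensor H A :=
  (TensorProduct.mk ℂ H A).compr₂
    (UniformSpace.Completion.toComplL (𝕜 := ℂ) (E := H ⊗[ℂ] A)).toLinearMap

theorem htmulₗ_apply (x : H) (y : A) : htmulₗ H A x y = htmul x y := rfl

theorem htmul_add_left (x x' : H) (y : A) : htmul (x + x') y = htmul x y + htmul x' y := by
  simp [← htmulₗ_apply]

theorem htmul_smul_left (c : ℂ) (x : H) (y : A) : htmul (c • x) y = c • htmul x y := by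
  simp [← htmulₗ_apply]

theorem htmul_smul_right (c : ℂ) (x : H) (y : A) : htmul x (c • y) = c • htmul x y := by
  simp [← htmulₗ_apply]

theorem dense_span_htmul :
    Dense (Submodule.span ℂ {z : HTensor H A | ∃ x y, htmul x y = z} : Set (HTensor H A)) := by
  refine (UniformSpace.Completion.denseRange_coe (α := H ⊗[ℂ] A)).mono ?_
  rintro _ ⟨t, rfl⟩
  induction t using TensorProduct.induction_on with
  | zero => exact Submodule.zero_mem _
  | tmul x y => exact Submodule.subset_span ⟨x, y, rfl⟩
  | add s t hs ht =>
    rw [UniformSpace.Completion.coe_add]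
    exact Submodule.add_mem _ hs ht

theorem eq_of_inner_htmul_left {z z' : HTensor H A}
    (h : ∀ x y, ⟪htmul x y, z⟫_ℂ = ⟪htmul x y, z'⟫_ℂ) : z = z' := by
  refine ext_inner_left ℂ fun v => ?_
  refine congrFun (f := fun v => ⟪v, z⟫_ℂ) (g := fun v => ⟪v, z'⟫_ℂ) ?_ v
  refine Continuous.ext_on dense_span_htmul (by fun_prop) (by fun_prop) fun v hv => ?_
  induction hv using Submodule.span_induction with
  | mem _ hv => obtain ⟨x, y, rfl⟩ := hv; exact h x y
  | zero => simp
  | add _ _ _ _ h₁ h₂ => simp only [inner_add_left] at *; rw [h₁, h₂]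
  | smul c _ _ h₁ => simp only [inner_smul_left] at *; rw [h₁]

theorem clm_ext_htmul {F : Type*} [NormedAddCommGroup F] [NormedSpace ℂ F]
    {S T : HTensor H A →L[ℂ] F} (h : ∀ x y, S (htmul x y) = T (htmul x y)) : S = T := by
  refine ContinuousLinearMap.ext_on dense_span_htmul ?_
  rintro _ ⟨x, y, rfl⟩
  exact h x y

theorem htmap_rankOne (x x' : H) (y y' : A) :
    htmap (InnerProductSpace.rankOne ℂ x x') (InnerProductSpace.rankOne ℂ y y') =
      InnerProductSpace.rankOne ℂ (htmul x y) (htmul x' y') := by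
  refine clm_ext_htmul fun v w => ?_
  rw [htmap_htmul, InnerProductSpace.rankOne_apply, InnerProductSpace.rankOne_apply,
    InnerProductSpace.rankOne_apply, htmul_smul_left, htmul_smul_right, smul_smul, inner_htmul]

/-- For `u ≠ 0`, `α` is the Riesz representer of `f ↦ ⟪z, u ⊗ f⟫` divided by `⟪u, u⟫`. Equality is
tested on product vectors `x ⊗ f`, splitting `x` into its projection on `u` and a part orthogonal to
`u`. -/
theorem exists_eq_htmul [CompleteSpace A] (u : H) (z : HTensor H A)
    (h : ∀ (x : H) (f : A), ⟪x, u⟫_ℂ = 0 → ⟪htmul x f, z⟫_ℂ = 0) :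
    ∃ α : A, z = htmul u α := by
  rcases eq_or_ne u 0 with rfl | hu
  · exact ⟨0, eq_of_inner_htmul_left fun x y => by simp [h x y, inner_htmul]⟩
  have huu : ⟪u, u⟫_ℂ ≠ 0 := inner_self_ne_zero.2 hu
  let φ : A →L[ℂ] ℂ := LinearMap.mkContinuous
    ((innerSL ℂ z).toLinearMap ∘ₗ htmulₗ H A u) (‖z‖ * ‖u‖) fun f => by
      rw [mul_assoc, ← norm_htmul]
      exact norm_inner_le_norm z (htmul u f)
  have hφ : ∀ f, φ f = ⟪z, htmul u f⟫_ℂ := fun _ => rfl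
  refine ⟨(⟪u, u⟫_ℂ)⁻¹ • (InnerProductSpace.toDual ℂ A).symm φ,
    eq_of_inner_htmul_left fun x f => ?_⟩
  have hu' : ⟪htmul u f, z⟫_ℂ = ⟪f, (InnerProductSpace.toDual ℂ A).symm φ⟫_ℂ := by
    rw [← inner_conj_symm, ← hφ, ← InnerProductSpace.toDual_symm_apply, inner_conj_symm]
  have hx := h (x - (⟪u, x⟫_ℂ / ⟪u, u⟫_ℂ) • u) f (by
    rw [inner_sub_left, inner_smul_left, map_div₀, inner_conj_symm, inner_conj_symm,
      div_mul_cancel₀ _ huu, sub_self])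
  have hdec : htmul x f = htmul (x - (⟪u, x⟫_ℂ / ⟪u, u⟫_ℂ) • u) f +
      (⟪u, x⟫_ℂ / ⟪u, u⟫_ℂ) • htmul u f := by
    rw [← htmul_smul_left, ← htmul_add_left, sub_add_cancel]
  rw [hdec, inner_add_left, hx, zero_add, inner_smul_left, hu', ← hdec, inner_htmul,
    inner_smul_right, map_div₀, inner_conj_symm, inner_conj_symm]
  ring

/-- If `(u + u') ⊗ α'' = u ⊗ α + u' ⊗ α'` for linearly independent `u`, `u'`, then `α = α''`. -/
theorem htmul_add_eq {u u' : H} (h : LinearIndependent ℂ ![u, u']) {α α' α'' : A}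
    (hadd : htmul (u + u') α'' = htmul u α + htmul u' α') : α = α'' := by
  refine ext_inner_left ℂ fun f => ?_
  have hu' : ⟪u', u'⟫_ℂ ≠ 0 := inner_self_ne_zero.2 (h.ne_zero 1)
  -- Pairing with `x ⊗ f`, where `x` is the part of `u` orthogonal to `u'`, removes `u'` from both
  -- sides; independence keeps `⟪x, u⟫` nonzero.
  set x := u - (⟪u', u⟫_ℂ / ⟪u', u'⟫_ℂ) • u' with hx
  have hxu' : ⟪x, u'⟫_ℂ = 0 := by
    rw [hx, inner_sub_left, inner_smul_left, map_div₀, inner_conj_symm, inner_conj_symm,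
      div_mul_cancel₀ _ hu', sub_self]
  have hx0 : x ≠ 0 := fun h0 => by
    have := LinearIndependent.pair_iff.1 h 1 (-(⟪u', u⟫_ℂ / ⟪u', u'⟫_ℂ))
      (by rw [one_smul, neg_smul, ← sub_eq_add_neg, ← hx, h0])
    exact one_ne_zero this.1
  have hxu : ⟪x, u⟫_ℂ ≠ 0 := by
    have : u = x + (⟪u', u⟫_ℂ / ⟪u', u'⟫_ℂ) • u' := by rw [hx, sub_add_cancel]
    rw [this, inner_add_right, inner_smul_right, hxu', mul_zero, add_zero]
    exact inner_self_ne_zero.2 hx0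
  have := congrArg (fun z => ⟪htmul x f, z⟫_ℂ) hadd
  simp only [inner_add_right, inner_htmul, hxu', zero_mul, add_zero] at this
  exact (mul_left_cancel₀ hxu this).symm

end Product

/-! ### Rank-one operators and proportional norms -/

section Operators

variable {H A : Type*}
  [NormedAddCommGroup H] [InnerProductSpace ℂ H]
  [NormedAddCommGroup A] [InnerProductSpace ℂ A]

theorem isDensity_rankOne {ψ : H} (hψ : ψ ≠ 0) : IsDensity (InnerProductSpace.rankOne ℂ ψ ψ) where
  ne_zero := InnerProductSpace.rankOne_ne_zero hψ hψ
  isPositive := InnerProductSpace.isPositive_rankOne_self ψ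
  summable_trace s e := by
    have h := e.summable_inner_mul_inner ψ ψ
    refine (Complex.reCLM.summable h).congr fun i => ?_
    simp [InnerProductSpace.rankOne_apply]

theorem conj_rankOne {K K' : Type*} [NormedAddCommGroup K] [InnerProductSpace ℂ K]
    [CompleteSpace K] [NormedAddCommGroup K'] [InnerProductSpace ℂ K'] [CompleteSpace K']
    (S : K →L[ℂ] K') (x : K) :
    S ∘L InnerProductSpace.rankOne ℂ x x ∘L ContinuousLinearMap.adjoint S =
      InnerProductSpace.rankOne ℂ (S x) (S x) := by
  rw [InnerProductSpace.rankOne_comp, ContinuousLinearMap.adjoint_adjoint,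
    InnerProductSpace.comp_rankOne]

theorem isometryEquiv_conj_rankOne {K K' : Type*} [NormedAddCommGroup K] [InnerProductSpace ℂ K]
    [NormedAddCommGroup K'] [InnerProductSpace ℂ K'] (e : K ≃ₗᵢ[ℂ] K') (x : K) :
    e.toContinuousLinearEquiv.toContinuousLinearMap ∘L InnerProductSpace.rankOne ℂ x x ∘L
      e.symm.toContinuousLinearEquiv.toContinuousLinearMap =
      InnerProductSpace.rankOne ℂ (e x) (e x) := by
  ext v
  simp [LinearIsometryEquiv.inner_map_eq_flip]

/-- Vanishing of the partial trace of `|w⟩⟨w|` in the direction `x`. -/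
theorem inner_htmul_eq_zero_of_hasPartialTrace [CompleteSpace A] {w : HTensor H A} {S : H →L[ℂ] H}
    (h : HasPartialTrace (InnerProductSpace.rankOne ℂ w w) S) {x : H} (hx : ⟪x, S x⟫_ℂ = 0)
    (f : A) : ⟪htmul x f, w⟫_ℂ = 0 := by
  rcases eq_or_ne f 0 with rfl | hf
  · rw [← htmulₗ_apply, map_zero, inner_zero_left]
  have hf' : (‖f‖ : ℂ) ≠ 0 := by exact_mod_cast norm_ne_zero_iff.2 hf
  -- The partial trace is tested on Hilbert bases: extend the normalized `f` to one. The diagonal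
  -- entry at `x` is then a sum of squares equal to zero, so each term vanishes.
  set g : A := (‖f‖ : ℂ)⁻¹ • f with hg
  have hfg : f = (‖f‖ : ℂ) • g := by rw [hg, smul_inv_smul₀ hf']
  have hgn : ‖g‖ = 1 := norm_smul_inv_norm hf
  have ho : Orthonormal ℂ ((↑) : ({g} : Set A) → A) :=
    ⟨by rintro ⟨_, rfl⟩; exact hgn, fun i j hij => (hij (Subsingleton.elim i j)).elim⟩
  obtain ⟨s, b, hs, hb⟩ := ho.exists_hilbertBasis_extension
  have hsum := Complex.hasSum_re (h s b x x)
  have hterm : ∀ j, (⟪htmul x (b j), InnerProductSpace.rankOne ℂ w w (htmul x (b j))⟫_ℂ).re =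
      ‖⟪htmul x (b j), w⟫_ℂ‖ ^ 2 := fun j => by
    rw [InnerProductSpace.rankOne_apply, inner_smul_right, ← inner_conj_symm, RCLike.conj_mul]
    norm_cast
  simp only [hterm, hx, Complex.zero_re] at hsum
  have h0 := (hasSum_zero_iff_of_nonneg fun _ => by positivity).1 hsum
  have hgz := congrFun h0 ⟨g, hs rfl⟩
  simp only [hb, Pi.zero_apply] at hgz
  rw [hfg, htmul_smul_right, inner_smul_left, norm_eq_zero.1 (pow_eq_zero_iff two_ne_zero |>.1 hgz),
    mul_zero]

/-- If `U` is injective and every `W ψ` is of the form `U ψ ⊗ α`, then the norms of `W ψ` and `U ψ`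
are proportional. -/
theorem norm_mul_norm_eq_of_eq_htmul {U : H →L[ℂ] H} (hU : ∀ ψ, U ψ = 0 → ψ = 0)
    {W : H →ₗ[ℂ] HTensor H A} (hW : ∀ ψ, ∃ α : A, W ψ = htmul (U ψ) α) (ψ ψ' : H) :
    ‖U ψ'‖ * ‖W ψ‖ = ‖U ψ‖ * ‖W ψ'‖ := by
  by_cases hli : LinearIndependent ℂ ![ψ, ψ']
  · have hker : U.toLinearMap.ker = ⊥ := LinearMap.ker_eq_bot'.2 hU
    have key : ∀ {ψ ψ' : H}, LinearIndependent ℂ ![ψ, ψ'] → LinearIndependent ℂ ![U ψ, U ψ'] :=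
      fun {ψ ψ'} h => by
        refine LinearIndependent.pair_iff.2 fun s t hst => LinearIndependent.pair_iff.1 h s t ?_
        exact hU _ (by simpa using hst)
    obtain ⟨α, hα⟩ := hW ψ
    obtain ⟨α', hα'⟩ := hW ψ'
    -- The garbage vector of the sum must equal each of the two garbage vectors.
    obtain ⟨α'', hα''⟩ := hW (ψ + ψ')
    rw [map_add, map_add, hα, hα'] at hα''
    have h1 : α = α'' := htmul_add_eq (key hli) hα''.symm
    have h2 : α' = α'' := htmul_add_eq (key (LinearIndependent.pair_symm_iff.1 hli))
      (by rw [add_comm, ← hα'', add_comm])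
    rw [hα, hα', norm_htmul, norm_htmul, h1, h2]
    ring
  · rcases eq_or_ne ψ 0 with rfl | hψ
    · simp
    obtain ⟨c, rfl⟩ : ∃ c : ℂ, c • ψ = ψ' := by
      simpa [LinearIndependent.pair_iff' hψ] using hli
    simp only [map_smul, norm_smul]
    ring

end Operators

/-! ### Output vectors for pure inputs -/

namespace QCircuit

variable {C : QCircuit} {H A : Type*}
  [NormedAddCommGroup H] [InnerProductSpace ℂ H]
  [NormedAddCommGroup A] [InnerProductSpace ℂ A]

/-- The state vector in `H ⊗ A` that path `μ` produces from the input vector `ψ` and the ancilla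
vector `a`. -/
def outVec (inp out : HTensor H A ≃ₗᵢ[ℂ] C.Space) (a : A) (μ : C.Path) : H →ₗ[ℂ] HTensor H A :=
  out.symm.toLinearEquiv.toLinearMap ∘ₗ (pathOp μ).toLinearMap ∘ₗ inp.toLinearEquiv.toLinearMap ∘ₗ
    (htmulₗ H A).flip a

theorem outVec_apply (inp out : HTensor H A ≃ₗᵢ[ℂ] C.Space) (a : A) (μ : C.Path) (ψ : H) :
    outVec inp out a μ ψ = out.symm (pathOp μ (inp (htmul ψ a))) := rfl

theorem tsum_enorm_outVec_sq (inp out : HTensor H A ≃ₗᵢ[ℂ] C.Space) {a : A} (ha : ‖a‖ = 1)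
    (ψ : H) : ∑' μ : C.Path, ‖outVec inp out a μ ψ‖ₑ ^ 2 = ‖ψ‖ₑ ^ 2 := by
  simp_rw [outVec_apply, LinearIsometryEquiv.enorm_map]
  rw [tsum_enorm_pathOp_sq, LinearIsometryEquiv.enorm_map, enorm_sq_eq_ofReal, norm_htmul, ha,
    mul_one, ← enorm_sq_eq_ofReal]

theorem fullOutput_rankOne (inp out : HTensor H A ≃ₗᵢ[ℂ] C.Space) (a : A) (μ : C.Path) (ψ : H) :
    fullOutput inp out a μ (InnerProductSpace.rankOne ℂ ψ ψ) =
      InnerProductSpace.rankOne ℂ (outVec inp out a μ ψ) (outVec inp out a μ ψ) := by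
  rw [fullOutput, fullInput, htmap_rankOne, isometryEquiv_conj_rankOne, output_eq, conj_rankOne]
  exact isometryEquiv_conj_rankOne out.symm _

/-- For `x ⊥ Uψ` the diagonal entry of `c |Uψ⟩⟨Uψ|` at `x` is zero, so the output vector is
orthogonal to every `x ⊗ f`. The value of `c` is irrelevant. -/
theorem ComputesAlong.exists_outVec_eq [CompleteSpace H] [CompleteSpace A]
    {inp out : HTensor H A ≃ₗᵢ[ℂ] C.Space} {a : A}
    {U : H →L[ℂ] H} {μ : C.Path} (h : ComputesAlong inp out a U μ) (ψ : H) :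
    ∃ α : A, outVec inp out a μ ψ = htmul (U ψ) α := by
  rcases eq_or_ne ψ 0 with rfl | hψ
  · exact ⟨0, by simp [← htmulₗ_apply]⟩
  obtain ⟨c, -, hc⟩ := h _ (isDensity_rankOne hψ)
  rw [fullOutput_rankOne, conj_rankOne] at hc
  refine exists_eq_htmul _ _ fun x f hx => inner_htmul_eq_zero_of_hasPartialTrace hc ?_ f
  simp [InnerProductSpace.rankOne_apply, hx]

end QCircuit

end QCirc

end

/-! ### Constancy of the ratio `‖ψ‖ / ‖Uψ‖` -/

open QCirc QCirc.QCircuit in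
theorem propositionB2 {H A : Type*}
    [NormedAddCommGroup H] [InnerProductSpace ℂ H] [CompleteSpace H]
    [TopologicalSpace.SeparableSpace H]
    [NormedAddCommGroup A] [InnerProductSpace ℂ A] [CompleteSpace A]
    [TopologicalSpace.SeparableSpace A]
    (hH : 2 ≤ Module.rank ℂ H)
    (C : QCirc.QCircuit)
    (inp out : QCirc.HTensor H A ≃ₗᵢ[ℂ] C.Space)
    (a : A) (ha : ‖a‖ = 1)
    (U : H →L[ℂ] H)
    (hU : ∀ μ : C.Path, QCirc.QCircuit.ComputesAlong inp out a U μ) :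
    ∃ t : ℝ, 0 < t ∧ ∀ ψ : H, ‖(t : ℂ) • U ψ‖ = ‖ψ‖ := by
  have hW := fun μ => (hU μ).exists_outVec_eq
  have hinj : ∀ ψ, U ψ = 0 → ψ = 0 := fun ψ hψ => by
    have hzero : ∀ μ, outVec inp out a μ ψ = 0 := fun μ => by
      obtain ⟨α, hα⟩ := hW μ ψ
      rw [hα, hψ, ← htmulₗ_apply, map_zero, LinearMap.zero_apply]
    have h := tsum_enorm_outVec_sq inp out ha ψ
    simp only [hzero, enorm_zero, ne_eq, two_ne_zero, not_false_eq_true, zero_pow, tsum_zero] at h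
    exact enorm_eq_zero.1 (pow_eq_zero_iff two_ne_zero |>.1 h.symm)
  have hmul : ∀ ψ ψ', ‖U ψ'‖ * ‖ψ‖ = ‖U ψ‖ * ‖ψ'‖ := fun ψ ψ' => by
    -- Expand `‖ψ‖²` and `‖ψ'‖²` as sums over paths; the cross-multiplied identity then holds path
    -- by path, with no division.
    have h : ‖U ψ'‖ₑ ^ 2 * ‖ψ‖ₑ ^ 2 = ‖U ψ‖ₑ ^ 2 * ‖ψ'‖ₑ ^ 2 := by
      rw [← tsum_enorm_outVec_sq inp out ha ψ, ← tsum_enorm_outVec_sq inp out ha ψ',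
        ← ENNReal.tsum_mul_left, ← ENNReal.tsum_mul_left]
      refine tsum_congr fun μ => ?_
      have := norm_mul_norm_eq_of_eq_htmul hinj (hW μ) ψ ψ'
      simp only [enorm_sq_eq_ofReal]
      rw [← ENNReal.ofReal_mul (by positivity), ← ENNReal.ofReal_mul (by positivity),
        ← mul_pow, ← mul_pow, this]
    simp only [enorm_sq_eq_ofReal] at h
    rw [← ENNReal.ofReal_mul (by positivity), ← ENNReal.ofReal_mul (by positivity),
      ← mul_pow, ← mul_pow, ENNReal.ofReal_eq_ofReal_iff (by positivity) (by positivity),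
      sq_eq_sq₀ (by positivity) (by positivity)] at h
    exact h
  have : Nontrivial H :=
    (rank_pos_iff_nontrivial (R := ℂ)).1 (lt_of_lt_of_le two_pos hH)
  obtain ⟨ψ₀, hψ₀⟩ := exists_ne (0 : H)
  have hpos : 0 < ‖ψ₀‖ := norm_pos_iff.2 hψ₀
  have hUpos : 0 < ‖U ψ₀‖ := norm_pos_iff.2 fun h => hψ₀ (hinj _ h)
  refine ⟨‖ψ₀‖ / ‖U ψ₀‖, by positivity, fun ψ => ?_⟩
  rw [norm_smul, Complex.norm_real, Real.norm_of_nonneg (by positivity), div_mul_eq_mul_div,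
    div_eq_iff hUpos.ne', mul_comm, hmul ψ₀ ψ, mul_comm]
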